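/- For a permutation $\pi=\pi_1\cdots\pi_m$ of $\{1,\dots,m\}$ let $\mathrm{exc}(\pi)=|\{i:\pi_i>i\}|$ and let $\mathrm{maj}(\pi)=\sum_{1\le i<m,\ \pi_i>\pi_{i+1}} i$. Put $A_m(t,q)=\sum_{\pi\in\mathfrak S_m}t^{\mathrm{exc}(\pi)}q^{\mathrm{maj}(\pi)-\mathrm{exc}(\pi)}$, and define the $q$-binomial-Eulerian polynomial $$\tilde A_n(t,q)=1+t\sum_{m=1}^n{n\brack m}_q A_m(t,q),\qquad {n\brack m}_q=\frac{(q;q)_n}{(q;q)_m(q;q)_{n-m}},\quad (q;q)_n=\prod_{i=1}^n(1-q^i),$$ where ${n\brack m}_q$ is regarded as a polynomial in $q$. Theorem. For every $n\ge 1$, the signed binomial-Eulerian polynomial $\tilde A_n(t,-1)$ is palindromic and unimodal. That is, $\tilde A_n(t,-1)=\sum_{i=0}^n h_it^i$ has degree $n$, $h_i=h_{n-i}$ for all $0\le i\le\lfloor n/2\rfloor$, and there is some $0\le c\le n$ with $h_0\le h_1\le\cdots\le h_c\ge h_{c+1}\ge\cdots\ge h_n$. -/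

import Mathlib

namespace QBinomialEulerian

open Polynomial

/-- `(q;q)_n = ∏_{i=1}^n (1 - q^i)`, as a polynomial in the variable `q`. -/
noncomputable def qPochhammer (n : ℕ) : ℤ[X] :=
  ∏ i ∈ Finset.Icc 1 n, (1 - X ^ i)

/-- The `q`-binomial coefficient as a polynomial in `q`, built by the `q`-Pascal rule.
By `qBinomial_mul` and `qPochhammer_ne_zero` below it is the quotient
`(q;q)_n / ((q;q)_m (q;q)_{n-m})`; being a polynomial, it can be evaluated at `q = -1`. -/
noncomputable def qBinomial : ℕ → ℕ → ℤ[X]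
  | _, 0 => 1
  | 0, _ + 1 => 0
  | n + 1, m + 1 => qBinomial n m + X ^ (m + 1) * qBinomial n (m + 1)

theorem qPochhammer_succ (n : ℕ) :
    qPochhammer (n + 1) = qPochhammer n * (1 - X ^ (n + 1)) := by
  unfold qPochhammer
  rw [Finset.prod_Icc_succ_top (by omega)]

theorem qPochhammer_ne_zero (n : ℕ) : qPochhammer n ≠ 0 := by
  unfold qPochhammer
  rw [Finset.prod_ne_zero_iff]
  intro i hi h
  have h0 : i ≠ 0 := by
    have := (Finset.mem_Icc.mp hi).1
    omega
  have := congrArg (Polynomial.eval 0) h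
  simp [h0] at this

theorem qBinomial_of_lt {n m : ℕ} (h : n < m) : qBinomial n m = 0 := by
  induction n generalizing m with
  | zero =>
    obtain ⟨k, rfl⟩ : ∃ k, m = k + 1 := ⟨m - 1, by omega⟩
    simp [qBinomial]
  | succ n ih =>
    obtain ⟨k, rfl⟩ : ∃ k, m = k + 1 := ⟨m - 1, by omega⟩
    simp [qBinomial, ih (show n < k by omega), ih (show n < k + 1 by omega)]

theorem qBinomial_mul {n m : ℕ} (h : m ≤ n) :
    qBinomial n m * (qPochhammer m * qPochhammer (n - m)) = qPochhammer n := by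
  induction n generalizing m with
  | zero =>
    obtain rfl : m = 0 := by omega
    simp [qBinomial, qPochhammer]
  | succ n ih =>
    cases m with
    | zero => simp [qBinomial, qPochhammer]
    | succ k =>
      have h1 := ih (show k ≤ n by omega)
      rcases Nat.lt_or_ge k n with hk | hk
      · have h2 := ih (show k + 1 ≤ n by omega)
        obtain ⟨b, rfl⟩ : ∃ b, n = k + 1 + b := ⟨n - (k + 1), by omega⟩
        have e1 : k + 1 + b - k = b + 1 := by omega
        have e2 : k + 1 + b - (k + 1) = b := by omega
        have e3 : k + 1 + b + 1 - (k + 1) = b + 1 := by omega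
        rw [e1] at h1
        rw [e2] at h2
        rw [e3, qBinomial, qPochhammer_succ (k + 1 + b), qPochhammer_succ k]
        rw [qPochhammer_succ b] at h1 ⊢
        rw [qPochhammer_succ k] at h2
        have e4 : (X : ℤ[X]) ^ (k + 1 + b + 1) = X ^ (k + 1) * X ^ (b + 1) := by
          rw [← pow_add]; congr 1
        rw [e4]
        linear_combination (1 - X ^ (k + 1)) * h1 + X ^ (k + 1) * (1 - X ^ (b + 1)) * h2
      · obtain rfl : k = n := by omega
        rw [qBinomial, qBinomial_of_lt (Nat.lt_succ_self k), qPochhammer_succ k]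
        simp only [Nat.sub_self] at h1 ⊢
        linear_combination (1 - X ^ (k + 1)) * h1

/-- The 0-based descent positions of `π`: the 1-based position of the descent `i` is `i + 1`. -/
def descents {n : ℕ} (π : Equiv.Perm (Fin n)) : Finset (Fin n) :=
  Finset.univ.filter fun i => ∃ h : (i : ℕ) + 1 < n, π ⟨i + 1, h⟩ < π i

/-- The major index: the sum of the 1-based descent positions. -/
def maj {n : ℕ} (π : Equiv.Perm (Fin n)) : ℕ :=
  ∑ i ∈ descents π, ((i : ℕ) + 1)

/-- The number of excedances (the last position is never an excedance). -/
def exc {n : ℕ} (π : Equiv.Perm (Fin n)) : ℕ :=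
  (Finset.univ.filter fun i => i < π i).card

/-- The subtraction `maj π - exc π` of natural numbers never truncates. -/
theorem exc_le_maj {n : ℕ} (π : Equiv.Perm (Fin n)) : exc π ≤ maj π := by
  classical
  rcases (Finset.univ.filter fun i => i < π i).eq_empty_or_nonempty with he | hne
  · simp [exc, he]
  · obtain ⟨p, hp, hmax⟩ := Finset.exists_max_image _ (fun i : Fin n => (i : ℕ)) hne
    have hp' : p < π p := (Finset.mem_filter.mp hp).2
    have hcard : exc π ≤ (p : ℕ) + 1 := by
      have hsub : (Finset.univ.filter fun i => i < π i) ⊆ Finset.Iic p := by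
        intro i hi
        exact Finset.mem_Iic.mpr (hmax i hi)
      simpa [exc] using Finset.card_le_card hsub
    have hdesc : ∃ d ∈ descents π, p ≤ d := by
      by_contra hcon
      push Not at hcon
      have key : ∀ k : ℕ, ∀ hk : (p : ℕ) + k < n, (p : ℕ) + k < (π ⟨p + k, hk⟩ : ℕ) := by
        intro k
        induction k with
        | zero => intro hk; simpa using hp'
        | succ k ih =>
          intro hk
          have hk' : (p : ℕ) + k < n := by omega
          have h1 := ih hk'
          have hnd : (⟨p + k, hk'⟩ : Fin n) ∉ descents π := by
            intro hd
            have := hcon _ hd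
            rw [Fin.lt_def] at this
            simp at this
          have h2 : (π ⟨p + k, hk'⟩ : ℕ) ≤ (π ⟨p + (k + 1), hk⟩ : ℕ) := by
            by_contra hlt
            exact hnd (Finset.mem_filter.mpr ⟨Finset.mem_univ _, hk, by
              rw [Fin.lt_def]; exact not_le.mp hlt⟩)
          have h3 : (π ⟨p + k, hk'⟩ : ℕ) ≠ (π ⟨p + (k + 1), hk⟩ : ℕ) := by
            intro heq
            have := congrArg Fin.val (π.injective (Fin.ext heq))
            simp at this
          omega
      have hpn := p.isLt
      have := key (n - 1 - p) (by omega)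
      have hb := (π ⟨p + (n - 1 - p), by omega⟩).isLt
      omega
    obtain ⟨d, hd, hpd⟩ := hdesc
    have hle : (d : ℕ) + 1 ≤ maj π :=
      Finset.single_le_sum (f := fun i : Fin n => (i : ℕ) + 1) (fun _ _ => Nat.zero_le _) hd
    have : (p : ℕ) ≤ d := hpd
    omega

/-- The `(maj, exc)`-Eulerian polynomial `A_n(t,q) = ∑_π t^{exc π} q^{maj π - exc π}`,
as a polynomial in `t` (the outer variable) over `ℤ[q]` (the inner variable). -/
noncomputable def qEulerian (n : ℕ) : ℤ[X][X] :=
  ∑ π : Equiv.Perm (Fin n), C (X ^ (maj π - exc π)) * X ^ exc π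

/-- The `q`-binomial-Eulerian polynomial `1 + t ∑_{m=1}^n [n choose m]_q A_m(t,q)`. -/
noncomputable def qBinomialEulerian (n : ℕ) : ℤ[X][X] :=
  1 + X * ∑ m ∈ Finset.Icc 1 n, C (qBinomial n m) * qEulerian m

/-- The signed binomial-Eulerian polynomial: the specialization `q = -1`,
a polynomial in `t`. -/
noncomputable def signedBinomialEulerian (n : ℕ) : ℤ[X] :=
  (qBinomialEulerian n).map (evalRingHom (-1))

/-- `p = ∑_{i=0}^d h_i t^i` of degree `d` is palindromic if `h_i = h_{d-i}` for `0 ≤ i ≤ ⌊d/2⌋`. -/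
def IsPalindromic {R : Type*} [Semiring R] (p : R[X]) : Prop :=
  ∀ i ≤ p.natDegree / 2, p.coeff i = p.coeff (p.natDegree - i)

/-- `p = ∑_{i=0}^d h_i t^i` of degree `d` is unimodal if
`h_0 ≤ h_1 ≤ ⋯ ≤ h_c ≥ h_{c+1} ≥ ⋯ ≥ h_d` for some `c`. -/
def IsUnimodal {R : Type*} [Semiring R] [LE R] (p : R[X]) : Prop :=
  ∃ c ≤ p.natDegree,
    (∀ i < c, p.coeff i ≤ p.coeff (i + 1)) ∧
    (∀ i, c ≤ i → i < p.natDegree → p.coeff (i + 1) ≤ p.coeff i)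

end QBinomialEulerian

namespace QBinomialEulerian

open Polynomial

/-! At `q = -1` the weight of a permutation is `(-1) ^ maj π * (-X) ^ exc π`, and only descents
inside the position pairs `(2j, 2j+1)` (0-based) affect the sign. Swapping the two values of a pair
cancels everything except permutations with `π (2j) = 2j+1` for all `j`. These are encoded by
permutations of the even points, so `A_m(t,-1) = (1+t)^⌊m/2⌋ A_⌈m/2⌉(t)` with the ordinary Eulerian
polynomial (`qEulerian_map_eval_neg_one`).

The q-binomials become ordinary binomials or zero (`eval_neg_one_qBinomial`). With `w_0 = 1`, `w_k =
t A_k` for `k ≥ 1`, and `w_k = ∑_j C(k,j) t^(k-j) d_j` for the derangement polynomials `d_j`,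
composing two binomial transforms gives, for `n = 2N`, `∑_j C(N,j) (1+t+t²)^(N-j) (1+t)^j d_j`. For
`n = 2N+1`, replace `d_j` by `(1+t) d_j + d_(j+1)`.

The recurrence for `d_j` makes it gamma-positive, hence symmetric and unimodal about `j/2`.
Multiplication by `1+t` and by `1+t+t²` preserves this property and moves the centre by `1/2` and
`1`, so all summands share the centre `n/2`. The constant term `1` then forces degree `n`. -/

/-! ### Symmetric unimodal polynomials -/

/-- The coefficient sequence of a polynomial, extended by zero to all integers. -/
noncomputable def intCoeff (p : ℤ[X]) (i : ℤ) : ℤ :=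
  if 0 ≤ i then p.coeff i.toNat else 0

theorem intCoeff_natCast (p : ℤ[X]) (i : ℕ) : intCoeff p i = p.coeff i := by
  simp [intCoeff]

theorem intCoeff_add (p r : ℤ[X]) (i : ℤ) :
    intCoeff (p + r) i = intCoeff p i + intCoeff r i := by
  unfold intCoeff
  split_ifs <;> simp

theorem intCoeff_mul_X (p : ℤ[X]) (i : ℤ) : intCoeff (p * X) i = intCoeff p (i - 1) := by
  unfold intCoeff
  rcases lt_trichotomy i 0 with h | rfl | h
  · rw [if_neg (by omega), if_neg (by omega)]
  · simp
  · rw [if_pos (by omega), if_pos (by omega)]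
    obtain ⟨k, rfl⟩ : ∃ k : ℕ, i = k + 1 := ⟨(i - 1).toNat, by omega⟩
    have : ((k : ℤ) + 1).toNat = k + 1 := by omega
    simp [this, coeff_mul_X]

/-- The coefficients of `p` are symmetric about `n / 2` and decrease with the distance to it. -/
def IsSymmUnimodal (n : ℕ) (p : ℤ[X]) : Prop :=
  ∀ i j : ℤ, (2 * i - n).natAbs ≤ (2 * j - n).natAbs → intCoeff p j ≤ intCoeff p i

namespace IsSymmUnimodal

theorem zero (n : ℕ) : IsSymmUnimodal n 0 := by
  intro i j _
  simp [intCoeff]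

theorem one : IsSymmUnimodal 0 1 := by
  intro i j h
  unfold intCoeff
  simp only [coeff_one]
  split_ifs <;> omega

theorem add {n : ℕ} {p r : ℤ[X]} (hp : IsSymmUnimodal n p) (hr : IsSymmUnimodal n r) :
    IsSymmUnimodal n (p + r) := by
  intro i j h
  rw [intCoeff_add, intCoeff_add]
  exact add_le_add (hp i j h) (hr i j h)

theorem nsmul {n : ℕ} {p : ℤ[X]} (hp : IsSymmUnimodal n p) (k : ℕ) :
    IsSymmUnimodal n (k • p) := by
  induction k with
  | zero => simpa using zero n
  | succ k ih => rw [succ_nsmul]; exact ih.add hp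

theorem sum {ι : Type*} {n : ℕ} {s : Finset ι} {f : ι → ℤ[X]}
    (h : ∀ i ∈ s, IsSymmUnimodal n (f i)) : IsSymmUnimodal n (∑ i ∈ s, f i) :=
  Finset.sum_induction f (IsSymmUnimodal n) (fun _ _ => add) (zero n) h

theorem mul_X {n : ℕ} {p : ℤ[X]} (hp : IsSymmUnimodal n p) : IsSymmUnimodal (n + 2) (p * X) := by
  intro i j h
  rw [intCoeff_mul_X, intCoeff_mul_X]
  exact hp _ _ (by push_cast at h; omega)

theorem mul_one_add_X {n : ℕ} {p : ℤ[X]} (hp : IsSymmUnimodal n p) :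
    IsSymmUnimodal (n + 1) (p * (1 + X)) := by
  intro i j h
  rw [mul_add, mul_one]
  simp only [intCoeff_add, intCoeff_mul_X]
  push_cast at h
  -- The windows `{i-1, i}` and `{j-1, j}` are matched in order when they lie on the same side of
  -- the centre, and crosswise otherwise.
  by_cases hs : 0 ≤ (2 * i - (n + 1)) ↔ 0 ≤ (2 * j - (n + 1))
  · have h1 := hp i j (by omega)
    have h2 := hp (i - 1) (j - 1) (by omega)
    omega
  · have h1 := hp i (j - 1) (by omega)
    have h2 := hp (i - 1) j (by omega)
    omega

theorem mul_one_add_X_add_X_sq {n : ℕ} {p : ℤ[X]} (hp : IsSymmUnimodal n p) :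
    IsSymmUnimodal (n + 2) (p * (1 + X + X ^ 2)) := by
  intro i j h
  rw [show p * (1 + X + X ^ 2) = p + p * X + p * X * X by ring]
  simp only [intCoeff_add, intCoeff_mul_X]
  push_cast at h
  have h0 := hp (i - 1) (j - 1) (by omega)
  -- If `i`'s window is centred exactly, the inner end of `j`'s window may also be the centre. It
  -- must then be compared with the middle of `i`'s window, so matching ends with ends fails.
  by_cases hu : 2 * i - 2 - n = 0
  · by_cases hj : 2 * i - 2 - n = 2 * j - 2 - n
    · obtain rfl : i = j := by omega
      exact le_rfl
    rcases le_total 0 (2 * j - 2 - n) with hv | hv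
    · have h1 := hp (i - 1) (j - 1 - 1) (by omega)
      have h2 := hp i j (by omega)
      have h3 := hp (i - 1 - 1) (j - 1) (by omega)
      omega
    · have h1 := hp (i - 1) j (by omega)
      have h2 := hp i (j - 1) (by omega)
      have h3 := hp (i - 1 - 1) (j - 1 - 1) (by omega)
      omega
  · by_cases hs : 0 ≤ (2 * i - 2 - n) ↔ 0 ≤ (2 * j - 2 - n)
    · have h1 := hp i j (by omega)
      have h2 := hp (i - 1 - 1) (j - 1 - 1) (by omega)
      omega
    · have h1 := hp i (j - 1 - 1) (by omega)
      have h2 := hp (i - 1 - 1) j (by omega)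
      omega

theorem mul_X_pow {n : ℕ} {p : ℤ[X]} (hp : IsSymmUnimodal n p) (k : ℕ) :
    IsSymmUnimodal (n + 2 * k) (p * X ^ k) := by
  induction k with
  | zero => simpa using hp
  | succ k ih => rw [pow_succ, ← mul_assoc]; exact ih.mul_X

theorem mul_one_add_X_pow {n : ℕ} {p : ℤ[X]} (hp : IsSymmUnimodal n p) (k : ℕ) :
    IsSymmUnimodal (n + k) (p * (1 + X) ^ k) := by
  induction k with
  | zero => simpa using hp
  | succ k ih => rw [pow_succ, ← mul_assoc]; exact ih.mul_one_add_X

theorem mul_one_add_X_add_X_sq_pow {n : ℕ} {p : ℤ[X]} (hp : IsSymmUnimodal n p) (k : ℕ) :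
    IsSymmUnimodal (n + 2 * k) (p * (1 + X + X ^ 2) ^ k) := by
  induction k with
  | zero => simpa using hp
  | succ k ih => rw [pow_succ, ← mul_assoc]; exact ih.mul_one_add_X_add_X_sq

theorem coeff_eq {n : ℕ} {p : ℤ[X]} (hp : IsSymmUnimodal n p) {i : ℕ} (hi : i ≤ n) :
    p.coeff i = p.coeff (n - i) := by
  rw [← intCoeff_natCast, ← intCoeff_natCast]
  exact le_antisymm (hp _ _ (by omega)) (hp _ _ (by omega))

/-- Reflection sends an index above `n` to a negative one, where `intCoeff` is zero by definition.
-/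
theorem coeff_eq_zero {n : ℕ} {p : ℤ[X]} (hp : IsSymmUnimodal n p) {i : ℕ} (hi : n < i) :
    p.coeff i = 0 := by
  have h : intCoeff p ((n : ℤ) - i) = 0 := by
    unfold intCoeff
    rw [if_neg (by omega)]
  rw [← intCoeff_natCast, ← h]
  exact le_antisymm (hp _ _ (by omega)) (hp _ _ (by omega))

theorem natDegree_eq {n : ℕ} {p : ℤ[X]} (hp : IsSymmUnimodal n p) (h0 : p.coeff 0 ≠ 0) :
    p.natDegree = n := by
  apply le_antisymm
  · exact natDegree_le_iff_coeff_eq_zero.mpr fun i hi => hp.coeff_eq_zero hi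
  · apply le_natDegree_of_ne_zero
    rw [hp.coeff_eq le_rfl]
    simpa using h0

theorem isPalindromic {n : ℕ} {p : ℤ[X]} (hp : IsSymmUnimodal n p) (h0 : p.coeff 0 ≠ 0) :
    IsPalindromic p := by
  intro i hi
  rw [hp.natDegree_eq h0] at hi ⊢
  exact hp.coeff_eq (by omega)

theorem isUnimodal {n : ℕ} {p : ℤ[X]} (hp : IsSymmUnimodal n p) (h0 : p.coeff 0 ≠ 0) :
    IsUnimodal p := by
  rw [IsUnimodal, hp.natDegree_eq h0]
  refine ⟨n / 2, by omega, fun i hi => ?_, fun i hi _ => ?_⟩ <;>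
    rw [← intCoeff_natCast, ← intCoeff_natCast] <;> exact hp _ _ (by omega)

end IsSymmUnimodal

/-! ### Gamma-positive polynomials -/

/-- The cone of polynomials with nonnegative integer coordinates in the basis
`X ^ i * (1 + X) ^ (n - 2 * i)`. -/
noncomputable def gammaCone (n : ℕ) : AddSubmonoid ℤ[X] :=
  AddSubmonoid.closure {p | ∃ i a, 2 * i + a = n ∧ p = X ^ i * (1 + X) ^ a}

theorem X_pow_mul_mem_gammaCone {n i a : ℕ} (h : 2 * i + a = n) :
    (X ^ i * (1 + X) ^ a : ℤ[X]) ∈ gammaCone n :=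
  AddSubmonoid.subset_closure ⟨i, a, h, rfl⟩

theorem isSymmUnimodal_of_mem_gammaCone {n : ℕ} {p : ℤ[X]} (hp : p ∈ gammaCone n) :
    IsSymmUnimodal n p := by
  induction hp using AddSubmonoid.closure_induction with
  | mem x hx =>
    obtain ⟨i, a, rfl, rfl⟩ := hx
    simpa using (IsSymmUnimodal.one.mul_X_pow i).mul_one_add_X_pow a
  | zero => exact .zero n
  | add x y _ _ hx hy => exact hx.add hy

theorem X_mul_mem_gammaCone {n : ℕ} {p : ℤ[X]} (hp : p ∈ gammaCone n) :
    X * p ∈ gammaCone (n + 2) := by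
  induction hp using AddSubmonoid.closure_induction with
  | mem x hx =>
    obtain ⟨i, a, rfl, rfl⟩ := hx
    rw [show (X : ℤ[X]) * (X ^ i * (1 + X) ^ a) = X ^ (i + 1) * (1 + X) ^ a by ring]
    exact X_pow_mul_mem_gammaCone (by ring)
  | zero => simp
  | add x y _ _ hx hy => rw [mul_add]; exact add_mem hx hy

theorem X_mul_derivative_X_pow (k : ℕ) : (X : ℤ[X]) * derivative (X ^ k) = (k : ℤ[X]) * X ^ k := by
  cases k with
  | zero => simp
  | succ k =>
    rw [derivative_X_pow, Nat.add_sub_cancel, pow_succ]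
    simp only [map_natCast]
    ring

/-- On a generator with `n = 2i + a` the operator gives `i X^i (1+X)^(a+1) + 2a X^(i+1)
(1+X)^(a-1)`, again with nonnegative coordinates. The case `a = 0` is separate because of the
exponent `a - 1`. -/
theorem derivation_mem_gammaCone {n : ℕ} {p : ℤ[X]} (hp : p ∈ gammaCone n) :
    (n : ℤ[X]) * X * p + X * (1 - X) * derivative p ∈ gammaCone (n + 1) := by
  induction hp using AddSubmonoid.closure_induction with
  | mem x hx =>
    obtain ⟨i, a, rfl, rfl⟩ := hx
    have hX := X_mul_derivative_X_pow i
    have hm : (i • (X ^ i * (1 + X) ^ (a + 1)) : ℤ[X]) ∈ gammaCone (2 * i + a + 1) :=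
      nsmul_mem (X_pow_mul_mem_gammaCone (by ring)) _
    cases a with
    | zero =>
      convert hm using 1
      simp only [pow_zero, mul_one, nsmul_eq_mul]
      push_cast
      linear_combination (1 - X) * hX
    | succ b =>
      have hm' : ((2 * (b + 1)) • (X ^ (i + 1) * (1 + X) ^ b) : ℤ[X]) ∈
          gammaCone (2 * i + (b + 1) + 1) :=
        nsmul_mem (X_pow_mul_mem_gammaCone (by ring)) _
      convert add_mem hm hm' using 1
      have hd : derivative ((1 + X : ℤ[X]) ^ (b + 1)) = ((b : ℤ[X]) + 1) * (1 + X) ^ b := by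
        simp [derivative_pow]
      rw [derivative_mul, hd]
      simp only [nsmul_eq_mul]
      push_cast
      linear_combination (1 - X) * (1 + X) ^ (b + 1) * hX
  | zero => simp
  | add x y _ _ hx hy =>
    convert add_mem hx hy using 1
    rw [derivative_add]
    ring

/-- The derangement polynomials, given by their differential recurrence. -/
noncomputable def derangementPoly : ℕ → ℤ[X]
  | 0 => 1
  | 1 => 0
  | n + 2 => ((n + 1 : ℕ) : ℤ[X]) * X * derangementPoly (n + 1) +
      X * (1 - X) * derivative (derangementPoly (n + 1)) +
      ((n + 1 : ℕ) : ℤ[X]) * X * derangementPoly n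

theorem derangementPoly_mem_gammaCone (n : ℕ) : derangementPoly n ∈ gammaCone n := by
  induction n using Nat.twoStepInduction with
  | zero => simpa [derangementPoly] using X_pow_mul_mem_gammaCone (n := 0) (i := 0) (a := 0) rfl
  | one => simp [derangementPoly]
  | more n h0 h1 =>
    rw [derangementPoly]
    refine add_mem (derivation_mem_gammaCone h1) ?_
    rw [mul_assoc, ← nsmul_eq_mul]
    exact nsmul_mem (X_mul_mem_gammaCone h0) _

/-! ### Binomial sums and the parity of the index -/

/-- `qBinomial n m` at `q = -1`. -/
theorem eval_neg_one_qBinomial (n m : ℕ) :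
    (qBinomial n m).eval (-1) =
      if Even n ∧ Odd m then 0 else (((n / 2).choose (m / 2) : ℕ) : ℤ) := by
  induction n generalizing m with
  | zero =>
    cases m with
    | zero => simp [qBinomial]
    | succ m =>
      rw [qBinomial, eval_zero]
      split_ifs with h
      · rfl
      · have hm : Even (m + 1) := by simpa using h
        obtain ⟨k, hk⟩ := hm
        rw [Nat.choose_eq_zero_of_lt (by omega), Nat.cast_zero]
  | succ n ih =>
    cases m with
    | zero => simp [qBinomial]
    | succ m =>
      rw [qBinomial, eval_add, eval_mul, eval_pow, eval_X, ih, ih]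
      -- Only when `n` and `m` are both odd does the q-Pascal rule become the ordinary Pascal rule.
      -- For `n` odd and `m` even its two terms cancel, and for `n` even one of them vanishes.
      rcases Nat.even_or_odd' n with ⟨a, rfl | rfl⟩ <;>
        rcases Nat.even_or_odd' m with ⟨b, rfl | rfl⟩
      · simp [parity_simps, pow_add, show (2 * a + 1) / 2 = a by omega,
          show (2 * b + 1) / 2 = b by omega]
      · simp [parity_simps, pow_add, pow_mul, show (2 * a + 1) / 2 = a by omega,
          show (2 * b + 1 + 1) / 2 = b + 1 by omega]
      · simp [parity_simps, pow_add, show (2 * a + 1) / 2 = a by omega,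
          show (2 * b + 1) / 2 = b by omega]
      · simp [parity_simps, pow_add, pow_mul, show (2 * a + 1) / 2 = a by omega,
          show (2 * a + 1 + 1) / 2 = a + 1 by omega, show (2 * b + 1) / 2 = b by omega,
          show (2 * b + 1 + 1) / 2 = b + 1 by omega, Nat.choose_succ_succ]

/-- Composition of two binomial transforms. -/
theorem sum_choose_mul_sum_choose {R : Type*} [CommRing R] (x y : R) (f : ℕ → R) (N : ℕ) :
    ∑ k ∈ Finset.range (N + 1), (N.choose k : R) * y ^ (N - k) *
        ∑ j ∈ Finset.range (k + 1), (k.choose j : R) * x ^ (k - j) * f j =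
      ∑ j ∈ Finset.range (N + 1), (N.choose j : R) * (x + y) ^ (N - j) * f j := by
  have h1 : ∀ k ∈ Finset.range (N + 1), (N.choose k : R) * y ^ (N - k) *
      ∑ j ∈ Finset.range (k + 1), (k.choose j : R) * x ^ (k - j) * f j =
      ∑ j ∈ Finset.range (k + 1), (N.choose k : R) * y ^ (N - k) *
        ((k.choose j : R) * x ^ (k - j) * f j) := fun k _ => Finset.mul_sum _ _ _
  rw [Finset.sum_congr rfl h1, Finset.sum_comm' (t' := Finset.range (N + 1))
    (s' := fun j => Finset.Ico j (N + 1))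
    (by intro k j; simp only [Finset.mem_range, Finset.mem_Ico]; omega)]
  refine Finset.sum_congr rfl fun j hj => ?_
  have hj' := Finset.mem_range.mp hj
  rw [Finset.sum_Ico_eq_sum_range, add_pow, show N + 1 - j = N - j + 1 by omega, Finset.mul_sum,
    Finset.sum_mul]
  refine Finset.sum_congr rfl fun i hi => ?_
  have hi' := Finset.mem_range.mp hi
  -- The trinomial revision `C(N,k) C(k,j) = C(N,j) C(N-j,k-j)`, with `k = j + i`, leaves the
  -- binomial expansion of `(x + y)^(N-j)`.
  have hc : ((N.choose (j + i) * (j + i).choose j : ℕ) : R) =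
      ((N.choose j * (N - j).choose i : ℕ) : R) := by
    rw [Nat.choose_mul (Nat.le_add_right j i), Nat.add_sub_cancel_left]
  rw [show N - (j + i) = N - j - i by omega, Nat.add_sub_cancel_left]
  push_cast at hc
  linear_combination y ^ (N - j - i) * x ^ i * f j * hc

/-! ### Eulerian polynomials -/

/-- The Eulerian polynomial, the generating function of excedances. -/
noncomputable def eulerianPoly (n : ℕ) : ℤ[X] := ∑ π : Equiv.Perm (Fin n), X ^ exc π

theorem exc_eq_sum {n : ℕ} (π : Equiv.Perm (Fin n)) : exc π = ∑ i, if i < π i then 1 else 0 := by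
  rw [exc, Finset.card_filter]

theorem exc_decomposeFin_symm_zero {n : ℕ} (e : Equiv.Perm (Fin n)) :
    exc (Equiv.Perm.decomposeFin.symm (0, e)) = exc e := by
  rw [exc_eq_sum, exc_eq_sum, Fin.sum_univ_succ]
  simp [Equiv.Perm.decomposeFin_symm_apply_succ]

/-- The new point `0` is inserted into the cycle of `e` between `i` and `e i`. It becomes an
excedance, while the position of `i`, now mapped to `0`, stops being one. -/
theorem exc_decomposeFin_symm_succ {n : ℕ} (e : Equiv.Perm (Fin n)) (i : Fin n) :
    exc (Equiv.Perm.decomposeFin.symm ((e i).succ, e)) =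
      if i < e i then exc e else exc e + 1 := by
  have h : ∀ k, (if k.succ < Equiv.swap 0 (e i).succ (e k).succ then 1 else 0) =
      if k = i then 0 else if k < e k then 1 else 0 := by
    intro k
    by_cases hk : k = i
    · simp [hk]
    · rw [Equiv.swap_apply_of_ne_of_ne (Fin.succ_ne_zero _) (by simpa using hk)]
      simp [hk]
  rw [exc_eq_sum, exc_eq_sum, Fin.sum_univ_succ]
  simp only [Equiv.Perm.decomposeFin_symm_apply_succ, Equiv.Perm.decomposeFin_symm_apply_zero, h]
  rw [← Finset.add_sum_erase _ _ (Finset.mem_univ i),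
    ← Finset.add_sum_erase (a := i) _ (fun k => if k < e k then 1 else 0) (Finset.mem_univ i)]
  have h' : ∑ k ∈ Finset.univ.erase i, (if k = i then 0 else if k < e k then 1 else 0) =
      ∑ k ∈ Finset.univ.erase i, if k < e k then 1 else 0 :=
    Finset.sum_congr rfl fun k hk => if_neg (Finset.ne_of_mem_erase hk)
  rw [h']
  by_cases hi : i < e i <;> simp [hi, Fin.succ_pos, add_comm]

theorem eulerianPoly_succ (n : ℕ) :
    eulerianPoly (n + 1) =
      (1 + (n : ℤ[X]) * X) * eulerianPoly n + X * (1 - X) * derivative (eulerianPoly n) := by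
  unfold eulerianPoly
  rw [derivative_sum, Finset.mul_sum, Finset.mul_sum, ← Finset.sum_add_distrib,
    ← Equiv.Perm.decomposeFin.symm.sum_comp, Fintype.sum_prod_type_right]
  refine Finset.sum_congr rfl fun e _ => ?_
  rw [Fin.sum_univ_succ, exc_decomposeFin_symm_zero,
    ← Equiv.sum_comp e fun i => X ^ exc (Equiv.Perm.decomposeFin.symm (i.succ, e))]
  simp only [exc_decomposeFin_symm_succ]
  -- Written linearly in the excedance indicator, the sum over `i` yields the factor `exc e`, which
  -- is what `X * derivative` extracts from `X ^ exc e`.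
  have h : ∀ i, (X : ℤ[X]) ^ (if i < e i then exc e else exc e + 1) =
      X * X ^ exc e + (1 - X) * X ^ exc e * ((if i < e i then 1 else 0 : ℕ) : ℤ[X]) := by
    intro i
    split_ifs <;> push_cast <;> ring
  rw [Finset.sum_congr rfl fun i _ => h i, Finset.sum_add_distrib, ← Finset.mul_sum,
    ← Finset.mul_sum, ← Nat.cast_sum, ← exc_eq_sum]
  simp only [Finset.sum_const, Finset.card_univ, Fintype.card_fin, nsmul_eq_mul]
  linear_combination -(1 - X) * X_mul_derivative_X_pow (exc e)

/-- The generating function of weak excedances: `1` for `n = 0` and `X * eulerianPoly n` else. -/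
noncomputable def weakEulerianPoly (n : ℕ) : ℤ[X] :=
  ∑ j ∈ Finset.range (n + 1), (n.choose j : ℤ[X]) * X ^ (n - j) * derangementPoly j

/-- The truncated index `n - 1` at `n = 0` is harmless, since its coefficient is zero. -/
theorem derangementPoly_succ (n : ℕ) : derangementPoly (n + 1) =
    (n : ℤ[X]) * X * derangementPoly n + X * (1 - X) * derivative (derangementPoly n) +
      (n : ℤ[X]) * X * derangementPoly (n - 1) := by
  cases n with
  | zero => simp [derangementPoly]
  | succ n => rw [derangementPoly, Nat.add_sub_cancel]

/-- Pascal's rule. It presents the polynomial of index `n + 1` as a binomial transform of length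
`n`, which the odd case also needs. -/
theorem weakEulerianPoly_succ_eq_sum (n : ℕ) :
    weakEulerianPoly (n + 1) = ∑ j ∈ Finset.range (n + 1), (n.choose j : ℤ[X]) * X ^ (n - j) *
      (X * derangementPoly j + derangementPoly (j + 1)) := by
  have h : ∑ j ∈ Finset.range (n + 1), (n.choose j : ℤ[X]) * X ^ (n - j) *
      (X * derangementPoly j) = ∑ j ∈ Finset.range (n + 1), (n.choose (j + 1) : ℤ[X]) *
        X ^ (n - j) * derangementPoly (j + 1) + X ^ (n + 1) * derangementPoly 0 := by
    rw [Finset.sum_range_succ', Finset.sum_range_succ _ n, Nat.choose_succ_self]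
    simp only [Nat.choose_zero_right, Nat.cast_zero, Nat.cast_one, zero_mul, add_zero, one_mul,
      Nat.sub_zero]
    congr 1
    · refine Finset.sum_congr rfl fun j hj => ?_
      rw [show n - j = n - (j + 1) + 1 by have := Finset.mem_range.mp hj; omega]
      ring
    · ring
  simp only [mul_add]
  rw [Finset.sum_add_distrib, h, weakEulerianPoly, Finset.sum_range_succ']
  simp only [Nat.choose_succ_succ, Nat.add_sub_add_right, Nat.cast_add, add_mul,
    Finset.sum_add_distrib]
  simp
  ring

theorem weakEulerianPoly_succ (n : ℕ) :
    weakEulerianPoly (n + 1) = ((n + 1 : ℕ) : ℤ[X]) * X * weakEulerianPoly n +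
      X * (1 - X) * derivative (weakEulerianPoly n) := by
  -- By `C(n,j+1) (j+1) = C(n,j) (n-j)`, the `derangementPoly (j - 1)` terms of the recurrence
  -- become the terms produced by differentiating `X ^ (n - j)`.
  have hshift : ∑ j ∈ Finset.range (n + 1), (n.choose j : ℤ[X]) * X ^ (n - j) *
        ((j : ℤ[X]) * X * derangementPoly (j - 1)) =
      ∑ j ∈ Finset.range (n + 1), (n.choose j : ℤ[X]) * X ^ (n - j) *
        (((n - j : ℕ) : ℤ[X]) * derangementPoly j) := by
    rw [Finset.sum_range_succ', Finset.sum_range_succ]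
    simp only [Nat.cast_zero, zero_mul, mul_zero, add_zero, Nat.sub_self]
    refine Finset.sum_congr rfl fun j hj => ?_
    have hj' := Finset.mem_range.mp hj
    obtain ⟨c, rfl⟩ : ∃ c, n = j + 1 + c := ⟨n - (j + 1), by omega⟩
    have hc : (((j + 1 + c).choose (j + 1) * (j + 1) : ℕ) : ℤ[X]) =
        (((j + 1 + c).choose j * (j + 1 + c - j) : ℕ) : ℤ[X]) := by
      rw [Nat.choose_succ_right_eq]
    rw [show j + 1 + c - (j + 1) = c by omega]
    rw [show j + 1 + c - j = c + 1 by omega] at hc ⊢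
    rw [Nat.add_sub_cancel]
    push_cast at hc ⊢
    linear_combination X ^ (c + 1) * derangementPoly j * hc
  have hd : X * derivative (weakEulerianPoly n) =
      ∑ j ∈ Finset.range (n + 1), (n.choose j : ℤ[X]) * X ^ (n - j) *
        (((n - j : ℕ) : ℤ[X]) * derangementPoly j + X * derivative (derangementPoly j)) := by
    rw [weakEulerianPoly, derivative_sum, Finset.mul_sum]
    refine Finset.sum_congr rfl fun j _ => ?_
    rw [derivative_mul, derivative_mul, derivative_natCast]
    linear_combination (n.choose j : ℤ[X]) * derangementPoly j * X_mul_derivative_X_pow (n - j)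
  have hs : weakEulerianPoly (n + 1) = ∑ j ∈ Finset.range (n + 1), (n.choose j : ℤ[X]) *
      X ^ (n - j) * (X * derangementPoly j + (j : ℤ[X]) * X * derangementPoly j +
        X * (1 - X) * derivative (derangementPoly j)) +
      ∑ j ∈ Finset.range (n + 1), (n.choose j : ℤ[X]) * X ^ (n - j) *
        (((n - j : ℕ) : ℤ[X]) * derangementPoly j) := by
    rw [← hshift, weakEulerianPoly_succ_eq_sum, ← Finset.sum_add_distrib]
    refine Finset.sum_congr rfl fun j _ => ?_
    rw [derangementPoly_succ]
    ring
  rw [mul_comm X (1 - X), mul_assoc (1 - X), hd, hs, weakEulerianPoly, Finset.mul_sum,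
    Finset.mul_sum, ← Finset.sum_add_distrib, ← Finset.sum_add_distrib]
  refine Finset.sum_congr rfl fun j hj => ?_
  rw [Nat.cast_sub (by have := Finset.mem_range.mp hj; omega)]
  push_cast
  ring

/-- Both sides satisfy the same recurrence. The index starts at one because the identity fails at
zero, where the left side is `1` and the right side `X`. -/
theorem weakEulerianPoly_succ_eq (n : ℕ) :
    weakEulerianPoly (n + 1) = X * eulerianPoly (n + 1) := by
  induction n with
  | zero =>
    simp [weakEulerianPoly, eulerianPoly, Finset.sum_range_succ, derangementPoly, exc]
  | succ n ih =>
    rw [weakEulerianPoly_succ, ih, eulerianPoly_succ (n + 1), derivative_mul, derivative_X]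
    push_cast
    ring

/-! ### The sign-reversing exchange at `q = -1` -/

/-- If the exchanges `τ j` fix all factors but the `j`-th ones, and the `j`-th
factors `f j` and `g j` have the same sums over `τ j`-pairs, then `f` may be replaced by `g`. -/
theorem sum_prod_eq_of_exchange {P ι R : Type*} [Fintype P] [DecidableEq ι] [CommRing R]
    [IsDomain R] [CharZero R] (τ : ι → P ≃ P) (f g : ι → P → R) (s : Finset ι)
    (hf : ∀ j k, j ≠ k → ∀ π, f k (τ j π) = f k π)
    (hg : ∀ j k, j ≠ k → ∀ π, g k (τ j π) = g k π)
    (hfg : ∀ j π, f j π + f j (τ j π) = g j π + g j (τ j π)) (h : P → R)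
    (hh : ∀ j ∈ s, ∀ π, h (τ j π) = h π) :
    ∑ π, h π * ∏ j ∈ s, f j π = ∑ π, h π * ∏ j ∈ s, g j π := by
  induction s using Finset.induction_on generalizing h with
  | empty => simp
  | insert a s ha ih =>
    have hne : ∀ j ∈ s, j ≠ a := fun j hj hja => ha (hja ▸ hj)
    have h1 : ∑ π, h π * ∏ j ∈ insert a s, f j π = ∑ π, (h π * ∏ j ∈ s, g j π) * f a π := by
      simp only [Finset.prod_insert ha, ← mul_assoc]
      -- The factor `f a` is invariant under the other exchanges, so it can be absorbed into the
      -- weight while they are processed.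
      rw [ih (fun π => h π * f a π) fun j hj π => by
        rw [hh j (Finset.mem_insert_of_mem hj), hf j a (hne j hj)]]
      exact Finset.sum_congr rfl fun π _ => by ring
    have h2 : ∑ π, h π * ∏ j ∈ insert a s, g j π = ∑ π, (h π * ∏ j ∈ s, g j π) * g a π := by
      simp only [Finset.prod_insert ha]
      exact Finset.sum_congr rfl fun π _ => by ring
    have hH : ∀ π, h (τ a π) * ∏ j ∈ s, g j (τ a π) = h π * ∏ j ∈ s, g j π := by
      intro π
      rw [hh a (Finset.mem_insert_self a s)]
      congr 1
      exact Finset.prod_congr rfl fun j hj => hg a j (hne j hj).symm π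
    have hdouble : ∀ u : P → R, 2 * ∑ π, (h π * ∏ j ∈ s, g j π) * u π =
        ∑ π, (h π * ∏ j ∈ s, g j π) * (u π + u (τ a π)) := by
      intro u
      rw [two_mul]
      nth_rewrite 2 [← (τ a).sum_comp]
      rw [← Finset.sum_add_distrib]
      refine Finset.sum_congr rfl fun π _ => ?_
      rw [hH]
      ring
    rw [h1, h2]
    -- Reindexing by `τ a` symmetrizes the doubled sums, and the symmetrized factors agree by `hfg`.
    apply mul_left_cancel₀ (two_ne_zero : (2 : R) ≠ 0)
    rw [hdouble, hdouble]
    exact Finset.sum_congr rfl fun π _ => by rw [hfg]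

/-! ### Pairs of adjacent positions and their weights. -/

variable {n : ℕ}

/-- The position `2 * j`, the lower one of the `j`-th pair of positions. -/
def pairFst (j : Fin (n / 2)) : Fin n := ⟨2 * j, by omega⟩

/-- The position `2 * j + 1`, the upper one of the `j`-th pair of positions. -/
def pairSnd (j : Fin (n / 2)) : Fin n := ⟨2 * j + 1, by omega⟩

theorem pairFst_ne_pairSnd (j k : Fin (n / 2)) : pairFst j ≠ pairSnd k := by
  simp only [pairFst, pairSnd, ne_eq, Fin.mk.injEq]
  omega

theorem pairFst_injective : Function.Injective (pairFst (n := n)) := by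
  intro j k h
  simp only [pairFst, Fin.mk.injEq] at h
  omega

theorem pairSnd_injective : Function.Injective (pairSnd (n := n)) := by
  intro j k h
  simp only [pairSnd, Fin.mk.injEq] at h
  omega

/-- For odd `n` the last position is unpaired. It is neither a descent nor an excedance, so its
factor is `1` in the applications. -/
theorem prod_univ_eq_prod_pairs {R : Type*} [CommMonoid R] (u : Fin n → R)
    (hu : ∀ i : Fin n, ¬ (i : ℕ) + 1 < n → u i = 1) :
    ∏ i, u i = ∏ j : Fin (n / 2), u (pairFst j) * u (pairSnd j) := by
  set v : ℕ → R := fun i => if h : i < n then u ⟨i, h⟩ else 1 with hv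
  have hpairs : ∀ m, ∏ i ∈ Finset.range (2 * m), v i =
      ∏ j ∈ Finset.range m, v (2 * j) * v (2 * j + 1) := by
    intro m
    induction m with
    | zero => simp
    | succ m ih =>
      rw [mul_add, mul_one, Finset.prod_range_succ, Finset.prod_range_succ, ih,
        Finset.prod_range_succ _ m, mul_assoc]
  have htop : ∏ i ∈ Finset.range n, v i = ∏ i ∈ Finset.range (2 * (n / 2)), v i := by
    refine (Finset.prod_subset (Finset.range_mono (by omega)) fun i hi hi' => ?_).symm
    rw [Finset.mem_range] at hi hi'
    simp only [hv, dif_pos hi]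
    exact hu _ (by simp only; omega)
  have hl : ∏ i, u i = ∏ i ∈ Finset.range n, v i := by
    rw [Finset.prod_range]
    exact Finset.prod_congr rfl fun i _ => by simp [hv]
  rw [hl, htop, hpairs, Finset.prod_range]
  refine Finset.prod_congr rfl fun j _ => ?_
  have h1 : 2 * (j : ℕ) < n := (pairFst j).isLt
  have h2 : 2 * (j : ℕ) + 1 < n := (pairSnd j).isLt
  simp only [hv, dif_pos h1, dif_pos h2]
  rfl

/-- The contribution of the `j`-th pair of positions to `(-1) ^ (maj π - exc π) * X ^ exc π`. -/
noncomputable def pairWeight (j : Fin (n / 2)) (π : Equiv.Perm (Fin n)) : ℤ[X] :=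
  (if π (pairSnd j) < π (pairFst j) then -1 else 1) *
    ((if pairFst j < π (pairFst j) then -X else 1) *
      (if pairSnd j < π (pairSnd j) then -X else 1))

/-- The contribution of the `j`-th pair after elimination in its lower position. -/
noncomputable def reducedPairWeight (j : Fin (n / 2)) (π : Equiv.Perm (Fin n)) : ℤ[X] :=
  if π (pairFst j) = pairSnd j then
    (1 + X) * (if pairSnd j < π (pairSnd j) then X else 1) else 0

/-- A descent at `pairFst` has odd 1-based position and contributes `-1`. One at `pairSnd` has even
position and contributes `1`, so descents between pairs are invisible. -/
theorem eval_neg_one_weight (π : Equiv.Perm (Fin n)) :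
    (C ((-1) ^ (maj π - exc π)) * X ^ exc π : ℤ[X]) = ∏ j, pairWeight j π := by
  have h1 : (C ((-1) ^ (maj π - exc π)) * X ^ exc π : ℤ[X]) = (-1) ^ maj π * (-X) ^ exc π := by
    obtain ⟨c, hc⟩ := Nat.exists_eq_add_of_le (exc_le_maj π)
    rw [hc, Nat.add_sub_cancel_left, pow_add, neg_pow (X : ℤ[X])]
    have : ((-1 : ℤ[X]) ^ exc π) * (-1) ^ exc π = 1 := by rw [← mul_pow]; simp
    simp only [map_pow, map_neg, map_one]
    linear_combination -(-1) ^ c * X ^ exc π * this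
  have hmaj : ((-1 : ℤ[X]) ^ maj π) = ∏ j : Fin (n / 2),
      if π (pairSnd j) < π (pairFst j) then -1 else 1 := by
    rw [maj, ← Finset.prod_pow_eq_pow_sum, descents, Finset.prod_filter, prod_univ_eq_prod_pairs]
    · refine Finset.prod_congr rfl fun j _ => ?_
      have hj := (pairSnd j).isLt
      have e1 : ((-1 : ℤ[X]) ^ ((pairFst j : ℕ) + 1)) = -1 := by simp [pairFst, pow_succ, pow_mul]
      have e2 : ((-1 : ℤ[X]) ^ ((pairSnd j : ℕ) + 1)) = 1 := by simp [pairSnd, pow_succ, pow_mul]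
      have hd : (∃ h : (pairFst j : ℕ) + 1 < n, π ⟨pairFst j + 1, h⟩ < π (pairFst j)) ↔
          π (pairSnd j) < π (pairFst j) := ⟨fun ⟨_, h⟩ => h, fun h => ⟨hj, h⟩⟩
      simp only [e1, e2, hd, ite_self, mul_one]
    · intro i hi
      rw [if_neg]
      rintro ⟨h, _⟩
      exact hi h
  have hexc : ((-X : ℤ[X]) ^ exc π) = ∏ j : Fin (n / 2),
      ((if pairFst j < π (pairFst j) then -X else 1) *
      (if pairSnd j < π (pairSnd j) then -X else 1)) := by
    rw [exc, ← Finset.prod_const, Finset.prod_filter, prod_univ_eq_prod_pairs]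
    intro i hi
    rw [if_neg]
    have := (π i).isLt
    rw [Fin.lt_def]
    omega
  rw [h1, hmaj, hexc, ← Finset.prod_mul_distrib]
  rfl

/-- Swapping the values of a pair reverses the sign and keeps the excedance count unless one value
is `2j+1`, the only value for which the two positions differ in excedance. If it occurs with another
value `b`, the two arrangements sum to `X + X²` for `b > 2j+1` and to `1 + X` for `b < 2j+1`. The
reduced weight puts this sum on the arrangement with `2j+1` first. -/
theorem sum_pairWeight_eq :
    ∑ π : Equiv.Perm (Fin n), ∏ j, pairWeight j π =
      ∑ π : Equiv.Perm (Fin n), ∏ j, reducedPairWeight j π := by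
  have hne : ∀ j k : Fin (n / 2), j ≠ k →
      Equiv.swap (pairFst j) (pairSnd j) (pairFst k) = pairFst k ∧
      Equiv.swap (pairFst j) (pairSnd j) (pairSnd k) = pairSnd k := fun j k h =>
    ⟨Equiv.swap_apply_of_ne_of_ne (pairFst_injective.ne h.symm) (pairFst_ne_pairSnd k j),
      Equiv.swap_apply_of_ne_of_ne (pairFst_ne_pairSnd j k).symm (pairSnd_injective.ne h.symm)⟩
  have := sum_prod_eq_of_exchange
    (fun j : Fin (n / 2) => Equiv.mulRight (Equiv.swap (pairFst j) (pairSnd j)))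
    pairWeight reducedPairWeight Finset.univ
    (fun j k h π => by simp [pairWeight, hne j k h])
    (fun j k h π => by simp [reducedPairWeight, hne j k h]) (fun j π => ?_)
    (fun _ => 1) (fun _ _ _ => rfl)
  · simpa using this
  · simp only [pairWeight, reducedPairWeight, Equiv.coe_mulRight, Equiv.Perm.mul_apply,
      Equiv.swap_apply_left, Equiv.swap_apply_right]
    have hab : π (pairFst j) ≠ π (pairSnd j) := π.injective.ne (pairFst_ne_pairSnd j j)
    generalize π (pairFst j) = a at *
    generalize π (pairSnd j) = b at *
    simp only [pairFst, pairSnd, Fin.lt_def, ne_eq, Fin.ext_iff] at *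
    split_ifs <;> first | (exfalso; omega) | ring

/-- The involution exchanging the two positions of every pair. -/
def pairFlip (n : ℕ) : Equiv.Perm (Fin n) :=
  Function.Involutive.toPerm
    (fun i => if (i : ℕ) % 2 = 0 then (if h : (i : ℕ) + 1 < n then ⟨i + 1, h⟩ else i)
      else ⟨i - 1, by omega⟩) <| by
    intro i
    ext
    dsimp only
    split_ifs <;> dsimp only at * <;> omega

theorem pairFlip_pairFst (j : Fin (n / 2)) : pairFlip n (pairFst j) = pairSnd j := by
  have := (pairSnd j).isLt
  simp only [pairSnd] at this
  ext
  simp [pairFlip, Function.Involutive.toPerm, pairFst, pairSnd, this]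

theorem pairFlip_pairSnd (j : Fin (n / 2)) : pairFlip n (pairSnd j) = pairFst j := by
  rw [← pairFlip_pairFst]
  exact Function.Involutive.toPerm_involutive _ _

/-- The even elements of `Fin n`. -/
def finEquivEven (n : ℕ) : Fin ((n + 1) / 2) ≃ {i : Fin n // (i : ℕ) % 2 = 0} where
  toFun j := ⟨⟨2 * j, by omega⟩, by simp⟩
  invFun i := ⟨i.1 / 2, by omega⟩
  left_inv j := by ext; simp
  right_inv i := by
    obtain ⟨i, hi⟩ := i
    ext
    simp only
    omega

/-- The permutation with `2 * j ↦ 2 * j + 1 ↦ 2 * σ j` on the pairs of positions. -/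
def pairedPerm (σ : Equiv.Perm (Fin ((n + 1) / 2))) : Equiv.Perm (Fin n) :=
  Equiv.Perm.ofSubtype ((finEquivEven n).permCongr σ) * pairFlip n

theorem pairedPerm_pairFst (σ : Equiv.Perm (Fin ((n + 1) / 2))) (j : Fin (n / 2)) :
    pairedPerm σ (pairFst j) = pairSnd j := by
  rw [pairedPerm, Equiv.Perm.mul_apply, pairFlip_pairFst, Equiv.Perm.ofSubtype_apply_of_not_mem]
  simp only [pairSnd]
  omega

theorem val_pairedPerm_pairSnd (σ : Equiv.Perm (Fin ((n + 1) / 2))) (j : Fin (n / 2)) :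
    (pairedPerm σ (pairSnd j) : ℕ) = 2 * σ (j.castLE (by omega)) := by
  have h : ((pairFst j : Fin n) : ℕ) % 2 = 0 := by simp [pairFst]
  have h' : (finEquivEven n).symm ⟨pairFst j, h⟩ = j.castLE (by omega) := by
    ext
    simp [finEquivEven, pairFst]
  have hmem := Equiv.Perm.ofSubtype_apply_of_mem (p := fun i : Fin n => (i : ℕ) % 2 = 0)
    ((finEquivEven n).permCongr σ) h
  rw [pairedPerm, Equiv.Perm.mul_apply, pairFlip_pairSnd, hmem, Equiv.permCongr_apply, h']
  rfl

theorem pairedPerm_injective : Function.Injective (pairedPerm (n := n)) := by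
  intro σ σ' h
  exact (finEquivEven n).permCongr.injective
    (Equiv.Perm.ofSubtype_injective (mul_right_cancel h))

/-- Undoing the flip leaves a permutation fixing every odd point, hence one of the even points
alone. -/
theorem exists_pairedPerm_eq {π : Equiv.Perm (Fin n)}
    (h : ∀ j : Fin (n / 2), π (pairFst j) = pairSnd j) : ∃ σ, pairedPerm σ = π := by
  have hfix : ∀ i : Fin n, ¬ (i : ℕ) % 2 = 0 → (π * (pairFlip n)⁻¹) i = i := by
    intro i hi
    obtain ⟨j, rfl⟩ : ∃ j : Fin (n / 2), i = pairSnd j :=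
      ⟨⟨i / 2, by omega⟩, by ext; simp only [pairSnd]; omega⟩
    rw [Equiv.Perm.mul_apply, ← pairFlip_pairFst, Equiv.Perm.inv_def,
      Equiv.symm_apply_apply, h, pairFlip_pairFst]
  obtain ⟨ρ, hρ⟩ := (Equiv.Perm.subtypeEquivSubtypePerm fun i : Fin n => (i : ℕ) % 2 = 0).surjective
    ⟨π * (pairFlip n)⁻¹, hfix⟩
  refine ⟨(finEquivEven n).permCongr.symm ρ, ?_⟩
  have : Equiv.Perm.ofSubtype ρ = π * (pairFlip n)⁻¹ := congrArg Subtype.val hρ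
  rw [pairedPerm, Equiv.apply_symm_apply, this, inv_mul_cancel_right]

theorem prod_reducedPairWeight_pairedPerm (σ : Equiv.Perm (Fin ((n + 1) / 2))) :
    ∏ j, reducedPairWeight j (pairedPerm σ) = (1 + X) ^ (n / 2) * X ^ exc σ := by
  have hX : (X : ℤ[X]) ^ exc σ = ∏ i, if i < σ i then X else 1 := by
    rw [exc, ← Finset.prod_const, Finset.prod_filter]
  have hle : n / 2 ≤ (n + 1) / 2 := by omega
  -- For odd `n`, `σ` acts on one more point than there are pairs. That point is the largest, so it
  -- is never an excedance.
  have hcast : ∏ j : Fin (n / 2), (if j.castLE hle < σ (j.castLE hle) then (X : ℤ[X]) else 1) =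
      ∏ i, if i < σ i then X else 1 := by
    refine Finset.prod_of_injOn (Fin.castLE hle) (Fin.castLE_injective hle).injOn
      (fun _ _ => Finset.mem_coe.mpr (Finset.mem_univ _)) (fun i _ hi => ?_) fun _ _ => rfl
    rw [if_neg]
    intro hlt
    have := (σ i).isLt
    exact hi ⟨⟨i, by rw [Fin.lt_def] at hlt; omega⟩, by simp, rfl⟩
  rw [hX, ← hcast]
  simp only [reducedPairWeight, pairedPerm_pairFst, if_true]
  rw [Finset.prod_mul_distrib, Finset.prod_const, Finset.card_univ, Fintype.card_fin]
  congr 1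
  refine Finset.prod_congr rfl fun j _ => if_congr ?_ rfl rfl
  rw [Fin.lt_def, val_pairedPerm_pairSnd, Fin.lt_def]
  simp only [pairSnd, Fin.val_castLE]
  -- `2j + 1 < 2 σ(j)` is equivalent to `j < σ(j)`.
  omega

theorem sum_reducedPairWeight_eq :
    ∑ π : Equiv.Perm (Fin n), ∏ j, reducedPairWeight j π =
      (1 + X) ^ (n / 2) * eulerianPoly ((n + 1) / 2) := by
  rw [eulerianPoly, Finset.mul_sum]
  refine (Finset.sum_of_injOn pairedPerm pairedPerm_injective.injOn
    (fun _ _ => Finset.mem_coe.mpr (Finset.mem_univ _)) (fun π _ hπ => ?_)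
    fun σ _ => (prod_reducedPairWeight_pairedPerm σ).symm).symm
  by_contra h0
  rw [← ne_eq, Finset.prod_ne_zero_iff] at h0
  have hgood : ∀ j : Fin (n / 2), π (pairFst j) = pairSnd j := by
    intro j
    by_contra hj
    exact h0 j (Finset.mem_univ j) (if_neg hj)
  obtain ⟨σ, rfl⟩ := exists_pairedPerm_eq hgood
  exact hπ ⟨σ, by simp, rfl⟩

theorem qEulerian_map_eval_neg_one (n : ℕ) :
    (qEulerian n).map (evalRingHom (-1)) = (1 + X) ^ (n / 2) * eulerianPoly ((n + 1) / 2) := by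
  rw [← sum_reducedPairWeight_eq, ← sum_pairWeight_eq, qEulerian, Polynomial.map_sum]
  refine Finset.sum_congr rfl fun π _ => ?_
  rw [← eval_neg_one_weight]
  simp

/-! ### The signed binomial-Eulerian polynomial -/

theorem signedBinomialEulerian_eq (n : ℕ) :
    signedBinomialEulerian n = 1 + X * ∑ m ∈ Finset.Icc 1 n,
      C ((qBinomial n m).eval (-1)) * ((1 + X) ^ (m / 2) * eulerianPoly ((m + 1) / 2)) := by
  simp only [signedBinomialEulerian, qBinomialEulerian, Polynomial.map_add, Polynomial.map_one,
    Polynomial.map_mul, map_X, Polynomial.map_sum, qEulerian_map_eval_neg_one, map_C,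
    coe_evalRingHom]

theorem signedBinomialEulerian_coeff_zero (n : ℕ) : (signedBinomialEulerian n).coeff 0 = 1 := by
  simp [signedBinomialEulerian_eq]

theorem sum_Icc_one_two_mul {M : Type*} [AddCommMonoid M] (F : ℕ → M) (N : ℕ) :
    ∑ m ∈ Finset.Icc 1 (2 * N), F m =
      ∑ k ∈ Finset.range N, (F (2 * k + 1) + F (2 * k + 2)) := by
  induction N with
  | zero => simp
  | succ N ih =>
    rw [mul_add, mul_one, Finset.sum_Icc_succ_top (by omega), Finset.sum_Icc_succ_top (by omega),
      ih, Finset.sum_range_succ, add_assoc]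

theorem weakEulerianPoly_zero : weakEulerianPoly 0 = 1 := by
  simp [weakEulerianPoly, derangementPoly]

/-- Odd `m` drop out because their q-binomials vanish. The leading `1` is the term `k = 0`. -/
theorem signedBinomialEulerian_two_mul (N : ℕ) :
    signedBinomialEulerian (2 * N) =
      ∑ k ∈ Finset.range (N + 1), (N.choose k : ℤ[X]) * (1 + X) ^ k * weakEulerianPoly k := by
  rw [signedBinomialEulerian_eq, sum_Icc_one_two_mul, Finset.sum_range_succ', Finset.mul_sum,
    add_comm]
  congr 1
  · refine Finset.sum_congr rfl fun k _ => ?_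
    rw [eval_neg_one_qBinomial, eval_neg_one_qBinomial, if_pos (by simp [parity_simps]),
      if_neg (by simp [parity_simps]), show (2 * k + 2) / 2 = k + 1 by omega,
      show (2 * k + 2 + 1) / 2 = k + 1 by omega, show 2 * N / 2 = N by omega,
      weakEulerianPoly_succ_eq]
    simp
    ring
  · simp [weakEulerianPoly_zero]

/-- The indices `m = 2k` and `m = 2k + 1` carry the same binomial `C(N,k)` and the same power of `1
+ X`, giving the two weak Eulerian summands. The leading `1` fills the place of `m = 0`. -/
theorem signedBinomialEulerian_two_mul_add_one (N : ℕ) :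
    signedBinomialEulerian (2 * N + 1) =
      ∑ k ∈ Finset.range (N + 1), (N.choose k : ℤ[X]) * (1 + X) ^ k *
        (weakEulerianPoly k + weakEulerianPoly (k + 1)) := by
  have h1 : ∀ k, C ((qBinomial (2 * N + 1) (2 * k + 1)).eval (-1)) *
      ((1 + X) ^ ((2 * k + 1) / 2) * eulerianPoly ((2 * k + 1 + 1) / 2)) =
      (N.choose k : ℤ[X]) * (1 + X) ^ k * eulerianPoly (k + 1) := by
    intro k
    rw [eval_neg_one_qBinomial, if_neg (by simp [parity_simps]),
      show (2 * k + 1) / 2 = k by omega, show (2 * k + 1 + 1) / 2 = k + 1 by omega,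
      show (2 * N + 1) / 2 = N by omega]
    simp [mul_assoc]
  have h2 : ∀ k, C ((qBinomial (2 * N + 1) (2 * k + 2)).eval (-1)) *
      ((1 + X) ^ ((2 * k + 2) / 2) * eulerianPoly ((2 * k + 2 + 1) / 2)) =
      (N.choose (k + 1) : ℤ[X]) * (1 + X) ^ (k + 1) * eulerianPoly (k + 1) := by
    intro k
    rw [eval_neg_one_qBinomial, if_neg (by simp [parity_simps]),
      show (2 * k + 2) / 2 = k + 1 by omega, show (2 * k + 2 + 1) / 2 = k + 1 by omega,
      show (2 * N + 1) / 2 = N by omega]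
    simp [mul_assoc]
  rw [signedBinomialEulerian_eq, Finset.sum_Icc_succ_top (by omega), sum_Icc_one_two_mul]
  simp only [h1, h2, mul_add, Finset.sum_add_distrib]
  rw [Finset.sum_range_succ' (fun k => (N.choose k : ℤ[X]) * (1 + X) ^ k * weakEulerianPoly k),
    Finset.sum_range_succ _ N]
  simp only [weakEulerianPoly_succ_eq, weakEulerianPoly_zero, Finset.mul_sum, mul_left_comm _ X]
  simp
  ring

/-- Binomial transforms of symmetric unimodal polynomials with the right centers of symmetry. -/
theorem isSymmUnimodal_sum_choose {c : ℕ} {e : ℕ → ℤ[X]}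
    (he : ∀ j, IsSymmUnimodal (j + c) (e j)) (N : ℕ) :
    IsSymmUnimodal (2 * N + c) (∑ k ∈ Finset.range (N + 1), (N.choose k : ℤ[X]) * (1 + X) ^ k *
      ∑ j ∈ Finset.range (k + 1), (k.choose j : ℤ[X]) * X ^ (k - j) * e j) := by
  -- Splitting `(1+X)^k = (1+X)^(k-j) (1+X)^j` turns the inner sum into a transform with parameter
  -- `X (1+X)`. Composing with parameter `1` produces `1 + X + X²`.
  have h := sum_choose_mul_sum_choose (X * (1 + X)) 1 (fun j => (1 + X) ^ j * e j) N
  have h' : ∑ k ∈ Finset.range (N + 1), (N.choose k : ℤ[X]) * (1 + X) ^ k *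
      ∑ j ∈ Finset.range (k + 1), (k.choose j : ℤ[X]) * X ^ (k - j) * e j =
      ∑ j ∈ Finset.range (N + 1), N.choose j • (e j * (1 + X) ^ j * (1 + X + X ^ 2) ^ (N - j)) := by
    trans ∑ j ∈ Finset.range (N + 1),
      (N.choose j : ℤ[X]) * (X * (1 + X) + 1) ^ (N - j) * ((1 + X) ^ j * e j)
    · rw [← h]
      refine Finset.sum_congr rfl fun k _ => ?_
      rw [one_pow, mul_one, mul_assoc, Finset.mul_sum]
      congr 1
      refine Finset.sum_congr rfl fun j hj => ?_
      obtain ⟨b, rfl⟩ : ∃ b, k = j + b := ⟨k - j, by have := Finset.mem_range.mp hj; omega⟩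
      rw [Nat.add_sub_cancel_left, mul_pow, pow_add]
      ring
    · refine Finset.sum_congr rfl fun j _ => ?_
      rw [nsmul_eq_mul, show (X * (1 + X) + 1 : ℤ[X]) = 1 + X + X ^ 2 by ring]
      ring
  rw [h']
  refine IsSymmUnimodal.sum fun j hj => IsSymmUnimodal.nsmul ?_ _
  have hj' := Finset.mem_range.mp hj
  rw [show 2 * N + c = j + c + j + 2 * (N - j) by omega]
  exact ((he j).mul_one_add_X_pow j).mul_one_add_X_add_X_sq_pow (N - j)

theorem isSymmUnimodal_derangementPoly (n : ℕ) : IsSymmUnimodal n (derangementPoly n) :=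
  isSymmUnimodal_of_mem_gammaCone (derangementPoly_mem_gammaCone n)

theorem isSymmUnimodal_signedBinomialEulerian (n : ℕ) :
    IsSymmUnimodal n (signedBinomialEulerian n) := by
  rcases Nat.even_or_odd' n with ⟨N, rfl | rfl⟩
  · rw [signedBinomialEulerian_two_mul]
    exact isSymmUnimodal_sum_choose (c := 0) isSymmUnimodal_derangementPoly N
  · rw [signedBinomialEulerian_two_mul_add_one]
    -- Both summands of `e j` have centre `(j + 1) / 2`. The factor `1 + X` combines the
    -- `derangementPoly j` term of index `k` with the `X * derangementPoly j` term of index `k + 1`.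
    convert isSymmUnimodal_sum_choose (c := 1)
      (e := fun j => derangementPoly j * (1 + X) + derangementPoly (j + 1))
      (fun j => (isSymmUnimodal_derangementPoly j).mul_one_add_X.add
        (isSymmUnimodal_derangementPoly (j + 1))) N using 4 with k
    rw [weakEulerianPoly_succ_eq_sum, weakEulerianPoly, ← Finset.sum_add_distrib]
    refine Finset.sum_congr rfl fun j _ => ?_
    ring

end QBinomialEulerian

theorem theorem1p3 (n : ℕ) (hn : 1 ≤ n) :
    (QBinomialEulerian.signedBinomialEulerian n).natDegree = n ∧
      QBinomialEulerian.IsPalindromic (QBinomialEulerian.signedBinomialEulerian n) ∧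
      QBinomialEulerian.IsUnimodal (QBinomialEulerian.signedBinomialEulerian n) := by
  have h := QBinomialEulerian.isSymmUnimodal_signedBinomialEulerian n
  have h0 : (QBinomialEulerian.signedBinomialEulerian n).coeff 0 ≠ 0 := by
    rw [QBinomialEulerian.signedBinomialEulerian_coeff_zero]
    exact one_ne_zero
  exact ⟨h.natDegree_eq h0, h.isPalindromic h0, h.isUnimodal h0⟩
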